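/- Let $K$ be an arbitrary field; algebras are associative unital $K$-algebras and isomorphisms are $K$-algebra isomorphisms. For $p,q\in K^*=K\setminus\{0\}$, the Gaddis two-parameter quantum Heisenberg algebra $G\mathcal{H}_{p,q}$ is the algebra generated by $t,x,y$ subject to the relations $$yx-qxy=t,\qquad xt=p\,tx,\qquad yt=p^{-1}ty.$$ For a polynomial $f\in K[t]$, the generalized Heisenberg algebra $\mathcal{H}(f)$ is the algebra generated by $x,y,t$ subject to the relations $$tx=xf,\qquad yt=fy,\qquad yx-xy=f-t.$$ **Theorem.** Let $p,q\in K^*$. There exists $f\in K[t]$ with $G\mathcal{H}_{p,q}\cong\mathcal{H}(f)$ if and only if either $p=1$ or $q=1$, but not both. More precisely, if $p=1$ and $q\neq1$, then $G\mathcal{H}_{p,q}\cong\mathcal{H}(qt)$; and if $p\neq1$ and $q=1$, then $G\mathcal{H}_{p,q}\cong\mathcal{H}(pt)$. In particular, $G\mathcal{H}_{1,1}$, which is isomorphic to the universal enveloping algebra of the 3-dimensional Heisenberg Lie algebra (with basis $x,y,t$, bracket $[y,x]=t$, and $t$ central), is not isomorphic to $\mathcal{H}(f)$ for any $f\in K[t]$.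 -/

import Mathlib

/-- The names of the three generators of the algebras below. -/
inductive HeisenbergGen : Type
  | x | y | t

/-- The free associative unital algebra `K⟨x, y, t⟩`. -/
abbrev HeisenbergFree (K : Type*) [Field K] : Type _ := FreeAlgebra K HeisenbergGen

/-- The generator `x` of `K⟨x, y, t⟩`. -/
abbrev HeisenbergFree.x (K : Type*) [Field K] : HeisenbergFree K :=
  FreeAlgebra.ι K HeisenbergGen.x

/-- The generator `y` of `K⟨x, y, t⟩`. -/
abbrev HeisenbergFree.y (K : Type*) [Field K] : HeisenbergFree K :=
  FreeAlgebra.ι K HeisenbergGen.y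

/-- The generator `t` of `K⟨x, y, t⟩`. -/
abbrev HeisenbergFree.t (K : Type*) [Field K] : HeisenbergFree K :=
  FreeAlgebra.ι K HeisenbergGen.t

open HeisenbergFree in
/-- The defining relations `yx - qxy = t`, `xt = p tx`, `yt = p⁻¹ ty`. -/
inductive GaddisRel {K : Type*} [Field K] (p q : Kˣ) :
    HeisenbergFree K → HeisenbergFree K → Prop
  | yx : GaddisRel p q (y K * x K - (q : K) • (x K * y K)) (t K)
  | xt : GaddisRel p q (x K * t K) ((p : K) • (t K * x K))
  | yt : GaddisRel p q (y K * t K) (((p⁻¹ : Kˣ) : K) • (t K * y K))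

/-- The Gaddis two-parameter quantum Heisenberg algebra `GH_{p,q}`, for `p, q ∈ K^*`. -/
abbrev GaddisHeisenberg {K : Type*} [Field K] (p q : Kˣ) : Type _ :=
  RingQuot (GaddisRel p q)

open HeisenbergFree in
/-- The defining relations `tx = x f`, `yt = f y`, `yx - xy = f - t`, where `f = f(t)`. -/
inductive GenHeisenbergRel {K : Type*} [Field K] (f : Polynomial K) :
    HeisenbergFree K → HeisenbergFree K → Prop
  | tx : GenHeisenbergRel f (t K * x K) (x K * Polynomial.aeval (t K) f)
  | yt : GenHeisenbergRel f (y K * t K) (Polynomial.aeval (t K) f * y K)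
  | yx : GenHeisenbergRel f (y K * x K - x K * y K) (Polynomial.aeval (t K) f - t K)

/-- The generalized Heisenberg algebra `H(f)`, for `f ∈ K[t]`. -/
abbrev GenHeisenberg {K : Type*} [Field K] (f : Polynomial K) : Type _ :=
  RingQuot (GenHeisenbergRel f)

/-- The 3-dimensional Heisenberg Lie algebra over `K`: the vector space with basis `x, y, t`
(coordinates `0, 1, 2`). The bracket, given below, is determined by `⁅y, x⁆ = t` and
`t` being central. -/
def HeisenbergLieAlgebra (K : Type*) : Type _ := Fin 3 → K

namespace HeisenbergLieAlgebra

instance (K : Type*) [Field K] : AddCommGroup (HeisenbergLieAlgebra K) :=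
  inferInstanceAs (AddCommGroup (Fin 3 → K))

instance (K : Type*) [Field K] : Module K (HeisenbergLieAlgebra K) :=
  inferInstanceAs (Module K (Fin 3 → K))

instance (K : Type*) [Field K] : Bracket (HeisenbergLieAlgebra K) (HeisenbergLieAlgebra K) :=
  ⟨fun u v => (![0, 0, u 1 * v 0 - u 0 * v 1] : Fin 3 → K)⟩

theorem bracket_zero {K : Type*} [Field K] (u v : HeisenbergLieAlgebra K) : ⁅u, v⁆ 0 = 0 := rfl

theorem bracket_one {K : Type*} [Field K] (u v : HeisenbergLieAlgebra K) : ⁅u, v⁆ 1 = 0 := rfl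

theorem bracket_two {K : Type*} [Field K] (u v : HeisenbergLieAlgebra K) :
    ⁅u, v⁆ 2 = u 1 * v 0 - u 0 * v 1 := rfl

theorem add_apply {K : Type*} [Field K] (u v : HeisenbergLieAlgebra K) (i : Fin 3) :
    (u + v) i = u i + v i := rfl

theorem smul_apply {K : Type*} [Field K] (c : K) (v : HeisenbergLieAlgebra K) (i : Fin 3) :
    (c • v) i = c * v i := rfl

theorem zero_apply {K : Type*} [Field K] (i : Fin 3) :
    (0 : HeisenbergLieAlgebra K) i = 0 := rfl

theorem ext' {K : Type*} {u v : HeisenbergLieAlgebra K}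
    (h0 : u 0 = v 0) (h1 : u 1 = v 1) (h2 : u 2 = v 2) : u = v := by
  funext i
  fin_cases i
  · exact h0
  · exact h1
  · exact h2

instance (K : Type*) [Field K] : LieRing (HeisenbergLieAlgebra K) where
  add_lie u v w := by
    apply ext' <;> simp only [bracket_zero, bracket_one, bracket_two, add_apply] <;> ring
  lie_add u v w := by
    apply ext' <;> simp only [bracket_zero, bracket_one, bracket_two, add_apply] <;> ring
  lie_self u := by
    apply ext' <;> simp only [bracket_zero, bracket_one, bracket_two, zero_apply] <;> ring
  leibniz_lie u v w := by
    apply ext' <;> simp only [bracket_zero, bracket_one, bracket_two, add_apply] <;> ring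

instance (K : Type*) [Field K] : LieAlgebra K (HeisenbergLieAlgebra K) where
  lie_smul c u v := by
    apply ext' <;> simp only [bracket_zero, bracket_one, bracket_two, smul_apply] <;> ring

end HeisenbergLieAlgebra

/-! When exactly one parameter is 1, the isomorphisms are explicit changes of generators. In the
other cases first-order deformations of characters obstruct them. A character of `GH_{p,q}`,
transported to `H(f)`, sends `t` to a fixed point `t₀` of `f` (`eval_char`).

If `p, q ≠ 1`, use the character `(1, 0, 0)`. Nearby in a commutative square-zero extension, `x` is
a unit, so the relations kill `t` and then `y`: one tangent direction is left. On the `H(f)` side,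
freezing `t` at `t₀` leaves `x` and `y` free, which gives two.

If `p = q = 1`, split on `f'(t₀)`. If it is 1, `H(f)` has three tangent directions at `(0, 0, t₀)`,
while `GH_{1,1}` has at most two because `t` is a commutator. Otherwise `H(f)` has a noncommutative
upper triangular 2 × 2 representation in which `x` has distinct diagonal entries; for `GH_{1,1}`
such an image is commutative, since `t` is a central commutator (`map_t_eq_zero`, `map_commute`). -/

/-! ### Generators and universal property of `GH_{p,q}` -/

namespace GaddisHeisenberg

variable {K : Type*} [Field K] {p q : Kˣ}

/-- The generator `x` of `GH_{p,q}`. -/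
def x (p q : Kˣ) : GaddisHeisenberg p q :=
  RingQuot.mkAlgHom K (GaddisRel p q) (HeisenbergFree.x K)

/-- The generator `y` of `GH_{p,q}`. -/
def y (p q : Kˣ) : GaddisHeisenberg p q :=
  RingQuot.mkAlgHom K (GaddisRel p q) (HeisenbergFree.y K)

/-- The generator `t` of `GH_{p,q}`. -/
def t (p q : Kˣ) : GaddisHeisenberg p q :=
  RingQuot.mkAlgHom K (GaddisRel p q) (HeisenbergFree.t K)

theorem y_mul_x : y p q * x p q - (q : K) • (x p q * y p q) = t p q := by
  simpa [x, y, t] using RingQuot.mkAlgHom_rel K (GaddisRel.yx (p := p) (q := q))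

theorem x_mul_t : x p q * t p q = (p : K) • (t p q * x p q) := by
  simpa only [x, y, t, map_mul, map_smul] using
    RingQuot.mkAlgHom_rel K (GaddisRel.xt (p := p) (q := q))

theorem y_mul_t : y p q * t p q = ((p⁻¹ : Kˣ) : K) • (t p q * y p q) := by
  simpa only [x, y, t, map_mul, map_smul] using
    RingQuot.mkAlgHom_rel K (GaddisRel.yt (p := p) (q := q))

variable {A : Type*} [Ring A] [Algebra K A]

/-- The universal property of `GH_{p,q}`. -/
def lift (a b c : A) (hyx : b * a - (q : K) • (a * b) = c) (hxt : a * c = (p : K) • (c * a))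
    (hyt : b * c = ((p⁻¹ : Kˣ) : K) • (c * b)) : GaddisHeisenberg p q →ₐ[K] A :=
  RingQuot.liftAlgHom K ⟨FreeAlgebra.lift K (fun | .x => a | .y => b | .t => c), by
    rintro _ _ (_ | _ | _)
    · simpa using hyx
    · simpa using hxt
    · simpa using hyt⟩

section lift

variable {a b c : A} (hyx : b * a - (q : K) • (a * b) = c) (hxt : a * c = (p : K) • (c * a))
    (hyt : b * c = ((p⁻¹ : Kˣ) : K) • (c * b))

@[simp] theorem lift_x : lift a b c hyx hxt hyt (x p q) = a := by simp [lift, x]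

@[simp] theorem lift_y : lift a b c hyx hxt hyt (y p q) = b := by simp [lift, y]

@[simp] theorem lift_t : lift a b c hyx hxt hyt (t p q) = c := by simp [lift, t]

end lift

theorem hom_ext {g h : GaddisHeisenberg p q →ₐ[K] A} (hx : g (x p q) = h (x p q))
    (hy : g (y p q) = h (y p q)) (ht : g (t p q) = h (t p q)) : g = h := by
  apply RingQuot.ringQuot_ext'
  apply FreeAlgebra.hom_ext
  funext i
  cases i
  · exact hx
  · exact hy
  · exact ht

/-- The relations already hold in `S`, so the universal property factors `g` through the inclusion.
This replaces induction on words. -/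
theorem map_mem (g : GaddisHeisenberg p q →ₐ[K] A) (S : Subalgebra K A) (hx : g (x p q) ∈ S)
    (hy : g (y p q) ∈ S) (ht : g (t p q) ∈ S) (w : GaddisHeisenberg p q) : g w ∈ S := by
  have key : g = S.val.comp (lift (p := p) (q := q) (⟨_, hx⟩ : S) ⟨_, hy⟩ ⟨_, ht⟩
      (Subtype.ext <| by simpa using congrArg g (y_mul_x (p := p) (q := q)))
      (Subtype.ext <| ((map_mul g _ _).symm.trans (congrArg g x_mul_t)).trans <| by
        rw [map_smul, map_mul]; rfl)
      (Subtype.ext <| ((map_mul g _ _).symm.trans (congrArg g y_mul_t)).trans <| by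
        rw [map_smul, map_mul]; rfl)) := by
    apply hom_ext <;> simp
  rw [key]
  exact Subtype.property _

/-- The character of `GH_{p,q}` at the point `(1, 0, 0)`. -/
def char (p q : Kˣ) : GaddisHeisenberg p q →ₐ[K] K :=
  lift 1 0 0 (by simp) (by simp) (by simp)

end GaddisHeisenberg

/-! ### Generators, universal property and characters of `H(f)` -/

namespace GenHeisenberg

open Polynomial

variable {K : Type*} [Field K] {f : K[X]}

/-- The generator `x` of `H(f)`. -/
def x (f : K[X]) : GenHeisenberg f :=
  RingQuot.mkAlgHom K (GenHeisenbergRel f) (HeisenbergFree.x K)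

/-- The generator `y` of `H(f)`. -/
def y (f : K[X]) : GenHeisenberg f :=
  RingQuot.mkAlgHom K (GenHeisenbergRel f) (HeisenbergFree.y K)

/-- The generator `t` of `H(f)`. -/
def t (f : K[X]) : GenHeisenberg f :=
  RingQuot.mkAlgHom K (GenHeisenbergRel f) (HeisenbergFree.t K)

theorem t_mul_x : t f * x f = x f * aeval (t f) f := by
  simpa only [x, y, t, map_mul, map_sub, aeval_algHom_apply] using
    RingQuot.mkAlgHom_rel K (GenHeisenbergRel.tx (f := f))

theorem y_mul_t : y f * t f = aeval (t f) f * y f := by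
  simpa only [x, y, t, map_mul, map_sub, aeval_algHom_apply] using
    RingQuot.mkAlgHom_rel K (GenHeisenbergRel.yt (f := f))

theorem y_mul_x : y f * x f - x f * y f = aeval (t f) f - t f := by
  simpa only [x, y, t, map_mul, map_sub, aeval_algHom_apply] using
    RingQuot.mkAlgHom_rel K (GenHeisenbergRel.yx (f := f))

variable {A : Type*} [Ring A] [Algebra K A]

/-- The universal property of `H(f)`. -/
def lift (a b c : A) (htx : c * a = a * aeval c f) (hyt : b * c = aeval c f * b)
    (hyx : b * a - a * b = aeval c f - c) : GenHeisenberg f →ₐ[K] A :=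
  RingQuot.liftAlgHom K ⟨FreeAlgebra.lift K (fun | .x => a | .y => b | .t => c), by
    rintro _ _ (_ | _ | _)
    · simpa [← aeval_algHom_apply] using htx
    · simpa [← aeval_algHom_apply] using hyt
    · simpa [← aeval_algHom_apply] using hyx⟩

section lift

variable {a b c : A} (htx : c * a = a * aeval c f) (hyt : b * c = aeval c f * b)
    (hyx : b * a - a * b = aeval c f - c)

@[simp] theorem lift_x : lift a b c htx hyt hyx (x f) = a := by simp [lift, x]

@[simp] theorem lift_y : lift a b c htx hyt hyx (y f) = b := by simp [lift, y]

@[simp] theorem lift_t : lift a b c htx hyt hyx (t f) = c := by simp [lift, t]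

end lift

theorem hom_ext {g h : GenHeisenberg f →ₐ[K] A} (hx : g (x f) = h (x f))
    (hy : g (y f) = h (y f)) (ht : g (t f) = h (t f)) : g = h := by
  apply RingQuot.ringQuot_ext'
  apply FreeAlgebra.hom_ext
  funext i
  cases i
  · exact hx
  · exact hy
  · exact ht

theorem map_mem (g : GenHeisenberg f →ₐ[K] A) (S : Subalgebra K A) (hx : g (x f) ∈ S)
    (hy : g (y f) ∈ S) (ht : g (t f) ∈ S) (w : GenHeisenberg f) : g w ∈ S := by
  have hf : S.val (aeval (⟨g (t f), ht⟩ : S) f) = g (aeval (t f) f) := by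
    rw [← aeval_algHom_apply, ← aeval_algHom_apply]; rfl
  have inj : Function.Injective S.val := Subtype.val_injective
  have key : g = S.val.comp (lift (f := f) (⟨_, hx⟩ : S) ⟨_, hy⟩ ⟨_, ht⟩
      (inj <| by
        rw [map_mul, map_mul, hf]; simpa using congrArg g t_mul_x)
      (inj <| by
        rw [map_mul, map_mul, hf]; simpa using congrArg g y_mul_t)
      (inj <| by
        rw [map_sub, map_sub, hf]; simpa using congrArg g y_mul_x)) := by
    apply hom_ext <;> simp
  rw [key]
  exact Subtype.property _

/-- A character of `H(f)` sends `t` to a fixed point of `f`. -/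
theorem eval_char (χ : GenHeisenberg f →ₐ[K] K) : f.eval (χ (t f)) = χ (t f) := by
  have h := congrArg χ (y_mul_x (f := f))
  rw [map_sub, map_sub, map_mul, map_mul, mul_comm, sub_self, ← aeval_algHom_apply,
    coe_aeval_eq_eval] at h
  exact (sub_eq_zero.mp h.symm)

end GenHeisenberg

/-- Evaluation of a linear monomial in a noncommutative algebra. -/
theorem Polynomial.aeval_C_mul_X {K A : Type*} [Field K] [Ring A] [Algebra K A] (r : K) (a : A) :
    Polynomial.aeval a (Polynomial.C r * Polynomial.X) = r • a := by
  simp [Algebra.smul_def]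

/-! ### Explicit isomorphisms -/

section Isomorphisms

open Polynomial

variable {K : Type*} [Field K]

/-- `GH_{1,q} ≅ H(qt)` for `q ≠ 1`. -/
theorem GaddisHeisenberg.nonempty_equiv_of_ne_one {q : Kˣ} (hq : q ≠ 1) :
    Nonempty (GaddisHeisenberg 1 q ≃ₐ[K] GenHeisenberg (C (q : K) * X)) := by
  have hq' : (q : K) - 1 ≠ 0 := sub_ne_zero.mpr (by simpa using hq)
  have h1 := GenHeisenberg.t_mul_x (f := C (q : K) * X)
  have h2 := GenHeisenberg.y_mul_t (f := C (q : K) * X)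
  have h3 := GenHeisenberg.y_mul_x (f := C (q : K) * X)
  rw [aeval_C_mul_X] at h1 h2 h3
  rw [mul_smul_comm] at h1
  rw [smul_mul_assoc] at h2
  rw [sub_eq_iff_eq_add] at h3
  have g1 := GaddisHeisenberg.y_mul_x (p := 1) (q := q)
  have g2 := GaddisHeisenberg.x_mul_t (p := 1) (q := q)
  have g3 := GaddisHeisenberg.y_mul_t (p := 1) (q := q)
  simp only [inv_one, Units.val_one, one_smul] at g2 g3
  rw [sub_eq_iff_eq_add] at g1
  set X' := GenHeisenberg.x (C (q : K) * X)
  set Y' := GenHeisenberg.y (C (q : K) * X)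
  set T' := GenHeisenberg.t (C (q : K) * X)
  set x' := GaddisHeisenberg.x 1 q
  set y' := GaddisHeisenberg.y 1 q
  set t' := GaddisHeisenberg.t 1 q
  -- The trailing factor `w` lets each relation rewrite inside a right-associated word.
  have h1' (w) : T' * (X' * w) = (q : K) • (X' * (T' * w)) := by
    rw [← mul_assoc, h1, smul_mul_assoc, mul_assoc]
  have h3' (w) : Y' * (X' * w) = ((q : K) • T' - T' + X' * Y') * w := by rw [← mul_assoc, h3]
  have g1' (w) : y' * (x' * w) = (t' + (q : K) • (x' * y')) * w := by rw [← mul_assoc, g1]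
  have g2' (w) : x' * (t' * w) = t' * (x' * w) := by rw [← mul_assoc, g2, mul_assoc]
  -- Since `YX = XY + (q - 1)T`, the element `YX - qXY` is `(1 - q)(XY - T)`. Solving for `T` gives
  -- the inverse, which needs `q ≠ 1`.
  refine ⟨AlgEquiv.ofAlgHom
    (GaddisHeisenberg.lift X' Y' ((1 - (q : K)) • (X' * Y' - T')) ?_ ?_ ?_)
    (GenHeisenberg.lift x' y' (x' * y' + ((q : K) - 1)⁻¹ • t') ?_ ?_ ?_) ?_ ?_⟩
  · rw [h3]; module
  · simp only [Units.val_one, one_smul, mul_smul_comm, smul_mul_assoc, mul_sub, sub_mul, mul_assoc,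
      h1, h3, mul_add]
    module
  · simp only [inv_one, Units.val_one, one_smul, mul_smul_comm, smul_mul_assoc, mul_sub, sub_mul,
      mul_assoc, h2, h3', add_mul]
    module
  · rw [aeval_C_mul_X]
    simp only [mul_smul_comm, smul_mul_assoc, mul_assoc, add_mul, mul_add, g1, g2, smul_add]
    match_scalars <;> field_simp <;> ring
  · rw [aeval_C_mul_X]
    simp only [mul_smul_comm, smul_mul_assoc, mul_assoc, add_mul, mul_add, g1', g3, smul_add]
    match_scalars <;> field_simp <;> ring
  · rw [aeval_C_mul_X, g1]
    match_scalars <;> field_simp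
  · apply GenHeisenberg.hom_ext
    · simp [X', x']
    · simp [Y', y']
    · simp only [T', x', y', t', AlgHom.comp_apply, GenHeisenberg.lift_t, map_add, map_mul,
        map_smul, GaddisHeisenberg.lift_x, GaddisHeisenberg.lift_y, GaddisHeisenberg.lift_t,
        AlgHom.id_apply]
      match_scalars <;> field_simp <;> ring
  · apply GaddisHeisenberg.hom_ext
    · simp [X', x']
    · simp [Y', y']
    · simp only [X', Y', T', x', y', t', AlgHom.comp_apply, GenHeisenberg.lift_t, map_sub, map_mul,
        map_smul, GaddisHeisenberg.lift_t, GenHeisenberg.lift_x, GenHeisenberg.lift_y,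
        AlgHom.id_apply]
      match_scalars <;> field_simp <;> ring

/-- `GH_{p,1} ≅ H(pt)` for `p ≠ 1`. -/
theorem GaddisHeisenberg.nonempty_equiv_of_one_right {p : Kˣ} (hp : p ≠ 1) :
    Nonempty (GaddisHeisenberg p 1 ≃ₐ[K] GenHeisenberg (C (p : K) * X)) := by
  have hp' : 1 - (p : K) ≠ 0 := sub_ne_zero.mpr (by simpa [eq_comm] using hp)
  have h1 := GenHeisenberg.t_mul_x (f := C (p : K) * X)
  have h2 := GenHeisenberg.y_mul_t (f := C (p : K) * X)
  have h3 := GenHeisenberg.y_mul_x (f := C (p : K) * X)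
  rw [aeval_C_mul_X] at h1 h2 h3
  rw [mul_smul_comm] at h1
  rw [smul_mul_assoc] at h2
  rw [sub_eq_iff_eq_add] at h3
  have g1 := GaddisHeisenberg.y_mul_x (p := p) (q := 1)
  have g2 := GaddisHeisenberg.x_mul_t (p := p) (q := 1)
  have g3 := GaddisHeisenberg.y_mul_t (p := p) (q := 1)
  simp only [Units.val_one, one_smul, Units.val_inv_eq_inv_val] at g1 g3
  rw [sub_eq_iff_eq_add] at g1
  -- `YT = pTY` has the shape of `xt = p tx`, so `x` and `y` are exchanged; the scalar comes from
  -- `XY - YX = (1 - p)T`.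
  refine ⟨AlgEquiv.ofAlgHom
    (GaddisHeisenberg.lift (GenHeisenberg.y (C (p : K) * X)) (GenHeisenberg.x (C (p : K) * X))
      ((1 - (p : K)) • GenHeisenberg.t (C (p : K) * X)) ?_ ?_ ?_)
    (GenHeisenberg.lift (GaddisHeisenberg.y p 1) (GaddisHeisenberg.x p 1)
      ((1 - (p : K))⁻¹ • GaddisHeisenberg.t p 1) ?_ ?_ ?_) ?_ ?_⟩
  · rw [h3, Units.val_one]; module
  · simp only [mul_smul_comm, smul_mul_assoc, h2]
    module
  · simp only [mul_smul_comm, smul_mul_assoc, h1, Units.val_inv_eq_inv_val]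
    match_scalars
    field_simp
  · rw [aeval_C_mul_X]
    simp only [mul_smul_comm, smul_mul_assoc, g3]
    match_scalars
    field_simp
  · rw [aeval_C_mul_X]
    simp only [mul_smul_comm, smul_mul_assoc, g2]
    module
  · rw [aeval_C_mul_X, g1]
    match_scalars <;> field_simp <;> ring
  · apply GenHeisenberg.hom_ext <;> simp [hp']
  · apply GaddisHeisenberg.hom_ext <;> simp [hp']

attribute [local instance 100] LieRing.ofAssociativeRing

/-- The enveloping algebra of the Heisenberg Lie algebra is `GH_{1,1}`. -/
theorem HeisenbergLieAlgebra.nonempty_universalEnvelopingAlgebra_equiv (K : Type*) [Field K] :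
    Nonempty (UniversalEnvelopingAlgebra K (HeisenbergLieAlgebra K) ≃ₐ[K]
      GaddisHeisenberg (1 : Kˣ) (1 : Kˣ)) := by
  have g1 := GaddisHeisenberg.y_mul_x (p := (1 : Kˣ)) (q := 1)
  have g2 := GaddisHeisenberg.x_mul_t (p := (1 : Kˣ)) (q := 1)
  have g3 := GaddisHeisenberg.y_mul_t (p := (1 : Kˣ)) (q := 1)
  simp only [inv_one, Units.val_one, one_smul] at g1 g2 g3
  rw [sub_eq_iff_eq_add] at g1
  let φ : HeisenbergLieAlgebra K →ₗ⁅K⁆ GaddisHeisenberg (1 : Kˣ) (1 : Kˣ) :=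
    { toFun := fun v => v 0 • GaddisHeisenberg.x 1 1 + v 1 • GaddisHeisenberg.y 1 1 +
        v 2 • GaddisHeisenberg.t 1 1
      map_add' := fun u v => by simp only [add_apply]; module
      map_smul' := fun c v => by simp only [smul_apply, RingHom.id_apply]; module
      map_lie' := fun {u v} => by
        simp only [bracket_zero, bracket_one, bracket_two, LieRing.of_associative_ring_bracket,
          mul_add, add_mul, smul_mul_assoc, mul_smul_comm, g1, g2, g3]
        module }
  have hφ (v) : φ v = v 0 • GaddisHeisenberg.x 1 1 + v 1 • GaddisHeisenberg.y 1 1 +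
        v 2 • GaddisHeisenberg.t 1 1 := rfl
  obtain ⟨X', hX0, hX1, hX2⟩ : ∃ v : HeisenbergLieAlgebra K,
      v 0 = 1 ∧ v 1 = 0 ∧ v 2 = 0 := ⟨(![1, 0, 0] : Fin 3 → K), rfl, rfl, rfl⟩
  obtain ⟨Y', hY0, hY1, hY2⟩ : ∃ v : HeisenbergLieAlgebra K,
      v 0 = 0 ∧ v 1 = 1 ∧ v 2 = 0 := ⟨(![0, 1, 0] : Fin 3 → K), rfl, rfl, rfl⟩
  obtain ⟨T', hT0, hT1, hT2⟩ : ∃ v : HeisenbergLieAlgebra K,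
      v 0 = 0 ∧ v 1 = 0 ∧ v 2 = 1 := ⟨(![0, 0, 1] : Fin 3 → K), rfl, rfl, rfl⟩
  have hX : φ X' = GaddisHeisenberg.x 1 1 := by simp [hφ, hX0, hX1, hX2]
  have hY : φ Y' = GaddisHeisenberg.y 1 1 := by simp [hφ, hY0, hY1, hY2]
  have hT : φ T' = GaddisHeisenberg.t 1 1 := by simp [hφ, hT0, hT1, hT2]
  have hYX : ⁅Y', X'⁆ = T' := by
    apply ext' <;> simp [bracket_zero, bracket_one, bracket_two, hX0, hX1, hY0, hY1, hT0, hT1, hT2]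
  have hXT : ⁅X', T'⁆ = 0 := by
    apply ext' <;> simp [bracket_zero, bracket_one, bracket_two, zero_apply, hX1, hT0, hT1]
  have hYT : ⁅Y', T'⁆ = 0 := by
    apply ext' <;> simp [bracket_zero, bracket_one, bracket_two, zero_apply, hY0, hT0, hT1]
  have hv (v : HeisenbergLieAlgebra K) : v = v 0 • X' + v 1 • Y' + v 2 • T' := by
    apply ext' <;> simp [add_apply, smul_apply, hX0, hX1, hX2, hY0, hY1, hY2, hT0, hT1, hT2]
  let ι := UniversalEnvelopingAlgebra.ι K (L := HeisenbergLieAlgebra K)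
  have e1 := congrArg ι hYX
  have e2 := congrArg ι hXT
  have e3 := congrArg ι hYT
  rw [LieHom.map_lie, LieRing.of_associative_ring_bracket] at e1 e2 e3
  rw [map_zero, sub_eq_zero] at e2 e3
  refine ⟨AlgEquiv.ofAlgHom (UniversalEnvelopingAlgebra.lift K φ)
    (GaddisHeisenberg.lift (ι X') (ι Y') (ι T') (by simpa using e1) (by simpa using e2)
      (by simpa using e3)) ?_ ?_⟩
  · apply GaddisHeisenberg.hom_ext <;> simp [ι, hX, hY, hT]
  · apply UniversalEnvelopingAlgebra.hom_ext
    ext v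
    conv_rhs => rw [hv v]
    simp [hφ, ι]

end Isomorphisms

/-! ### Square-zero extensions and first-order expansions -/

section SquareZero

variable {K : Type*} [Field K] {n : ℕ}

/-- The subalgebra `K ⊕ N` of the square-zero extension `K ⊕ Kⁿ`. -/
def TrivSqZeroExt.subalgebraOfSubmodule (N : Submodule K (Fin n → K)) :
    Subalgebra K (TrivSqZeroExt K (Fin n → K)) where
  carrier := {w | w.snd ∈ N}
  mul_mem' {a b} ha hb := by
    have h := N.add_mem (N.smul_mem a.fst hb) (N.smul_mem b.fst ha)
    simpa using h
  add_mem' ha hb := N.add_mem ha hb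
  algebraMap_mem' r := by simp [TrivSqZeroExt.algebraMap_eq_inl]

theorem TrivSqZeroExt.mem_subalgebraOfSubmodule {N : Submodule K (Fin n → K)}
    {w : TrivSqZeroExt K (Fin n → K)} :
    w ∈ TrivSqZeroExt.subalgebraOfSubmodule N ↔ w.snd ∈ N := Iff.rfl

/-- Fewer than `n` vectors do not span `Kⁿ`. -/
theorem exists_single_notMem_span {s : Finset (Fin n → K)} (hs : s.card < n) :
    ∃ i : Fin n, Pi.single i (1 : K) ∉ Submodule.span K (s : Set (Fin n → K)) := by
  by_contra! h
  have htop : Submodule.span K (s : Set (Fin n → K)) = ⊤ := by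
    rw [eq_top_iff, ← (Pi.basisFun K (Fin n)).span_eq, Submodule.span_le]
    rintro _ ⟨i, rfl⟩
    simpa using h i
  have h1 := finrank_span_finset_le_card (R := K) s
  rw [Set.finrank, htop, finrank_top, Module.finrank_fin_fun] at h1
  omega

end SquareZero

namespace Polynomial

variable {K : Type*} [Field K] {A : Type*} [Ring A] [Algebra K A]

/-- First-order Taylor expansion at a scalar plus an element of square zero. -/
theorem aeval_algebraMap_add_of_sq_eq_zero (f : K[X]) (r : K) {m : A} (hm : m * m = 0) :
    aeval (algebraMap K A r + m) f =
      algebraMap K A (f.eval r) + f.derivative.eval r • m := by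
  -- Divide by `X - r` twice: `f'(r) = g(r)`, and the term with `h` carries `m * m`. No factorial is
  -- inverted, so the characteristic is arbitrary.
  obtain ⟨g, hg⟩ := X_sub_C_dvd_sub_C_eval (a := r) (p := f)
  obtain ⟨h, hh⟩ := X_sub_C_dvd_sub_C_eval (a := r) (p := g)
  have hd : f.derivative.eval r = g.eval r := by
    rw [sub_eq_iff_eq_add.mp hg]; simp
  rw [hd]
  conv_lhs => rw [sub_eq_iff_eq_add.mp hg, sub_eq_iff_eq_add.mp hh]
  simp [mul_add, ← mul_assoc, hm, Algebra.smul_def, add_comm, Algebra.commutes]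

end Polynomial

/-! ### Obstructions to isomorphism -/

section Nonexistence

open Polynomial TrivSqZeroExt

variable {K : Type*} [Field K] {p q : Kˣ} {f : K[X]}

/-- Compares tangent directions at the character `(1, 0, 0)`: at most one for `GH_{p,q}`, at least
two for `H(f)`. -/
theorem GaddisHeisenberg.isEmpty_equiv_of_ne_one (hp : p ≠ 1) (hq : q ≠ 1) :
    IsEmpty (GaddisHeisenberg p q ≃ₐ[K] GenHeisenberg f) := by
  refine ⟨fun e => ?_⟩
  let χ : GenHeisenberg f →ₐ[K] K := (GaddisHeisenberg.char p q).comp e.symm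
  have hfix := GenHeisenberg.eval_char χ
  set t₀ := χ (GenHeisenberg.t f) with ht₀
  have hev : aeval (algebraMap K (TrivSqZeroExt K (Fin 2 → K)) t₀) f = algebraMap K _ t₀ := by
    rw [aeval_algebraMap_apply_eq_algebraMap_eval, hfix]
  let ψ : GenHeisenberg f →ₐ[K] TrivSqZeroExt K (Fin 2 → K) :=
    GenHeisenberg.lift (inl (χ (GenHeisenberg.x f)) + inr (Pi.single 0 1))
      (inl (χ (GenHeisenberg.y f)) + inr (Pi.single 1 1)) (algebraMap K _ t₀)
      (by rw [hev, mul_comm]) (by rw [hev, mul_comm]) (by rw [hev, mul_comm]; simp)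
  have hψ : (fstHom K K (Fin 2 → K)).comp ψ = χ := by
    apply GenHeisenberg.hom_ext <;> simp [ψ, ht₀, TrivSqZeroExt.algebraMap_eq_inl]
  let g : GaddisHeisenberg p q →ₐ[K] TrivSqZeroExt K (Fin 2 → K) := ψ.comp e
  set a := g (GaddisHeisenberg.x p q) with ha
  set b := g (GaddisHeisenberg.y p q) with hb
  set c := g (GaddisHeisenberg.t p q) with hc
  have ha1 : a.fst = 1 := by
    have := DFunLike.congr_fun hψ (e (GaddisHeisenberg.x p q))
    simpa [χ, GaddisHeisenberg.char, ha, g] using this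
  have hunit : IsUnit a := by
    rw [TrivSqZeroExt.isUnit_iff_isUnit_fst, ha1]; exact isUnit_one
  have hac : a * c = (p : K) • (a * c) := by
    have := congrArg g (GaddisHeisenberg.x_mul_t (p := p) (q := q))
    rwa [map_smul, map_mul, map_mul, mul_comm (g (GaddisHeisenberg.t p q))] at this
  have hp' : 1 - (p : K) ≠ 0 := sub_ne_zero.mpr (by simpa [eq_comm] using hp)
  have hq' : 1 - (q : K) ≠ 0 := sub_ne_zero.mpr (by simpa [eq_comm] using hq)
  have hc0 : c = 0 := by
    have h : (1 - (p : K)) • (a * c) = 0 := by rw [sub_smul, one_smul, sub_eq_zero]; exact hac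
    exact (hunit.mul_right_eq_zero).mp ((smul_eq_zero.mp h).resolve_left hp')
  have hb0 : b = 0 := by
    have h : (1 - (q : K)) • (a * b) = 0 := by
      have := congrArg g (GaddisHeisenberg.y_mul_x (p := p) (q := q))
      rw [map_sub, map_smul, map_mul, map_mul, ← hc, hc0,
        mul_comm (g (GaddisHeisenberg.y p q))] at this
      rw [sub_smul, one_smul]; exact this
    exact (hunit.mul_right_eq_zero).mp ((smul_eq_zero.mp h).resolve_left hq')
  -- Only `a` still contributes a nilpotent part, and one vector cannot span `K²`.
  obtain ⟨i, hi⟩ := exists_single_notMem_span (s := {a.snd}) (by simp)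
  have hmem (w) := GaddisHeisenberg.map_mem g (subalgebraOfSubmodule
    (Submodule.span K (({a.snd} : Finset (Fin 2 → K)) : Set (Fin 2 → K))))
    (Submodule.subset_span (by simp [ha]))
    (by rw [← hb, hb0]; exact zero_mem _) (by rw [← hc, hc0]; exact zero_mem _) w
  apply hi
  fin_cases i
  · simpa [g, ψ, mem_subalgebraOfSubmodule] using hmem (e.symm (GenHeisenberg.x f))
  · simpa [g, ψ, mem_subalgebraOfSubmodule] using hmem (e.symm (GenHeisenberg.y f))

theorem GaddisHeisenberg.isEmpty_equiv_of_derivative_eq_one {t₀ : K} (hfix : f.eval t₀ = t₀)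
    (hder : f.derivative.eval t₀ = 1) :
    IsEmpty (GaddisHeisenberg (1 : Kˣ) 1 ≃ₐ[K] GenHeisenberg f) := by
  refine ⟨fun e => ?_⟩
  -- Because `f'(t₀) = 1`, `f` fixes `T` to first order, so `t` may move along with `x` and `y`.
  let T : TrivSqZeroExt K (Fin 3 → K) := algebraMap K _ t₀ + inr (Pi.single 2 1)
  have hev : aeval T f = T := by
    rw [aeval_algebraMap_add_of_sq_eq_zero _ _ (by simp), hfix, hder, one_smul]
  let ψ : GenHeisenberg f →ₐ[K] TrivSqZeroExt K (Fin 3 → K) :=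
    GenHeisenberg.lift (inr (Pi.single 0 1)) (inr (Pi.single 1 1)) T
      (by rw [hev, mul_comm]) (by rw [hev, mul_comm]) (by rw [hev, mul_comm]; simp)
  let g : GaddisHeisenberg (1 : Kˣ) 1 →ₐ[K] TrivSqZeroExt K (Fin 3 → K) := ψ.comp e
  have hc0 : g (GaddisHeisenberg.t 1 1) = 0 := by
    rw [← GaddisHeisenberg.y_mul_x, map_sub, map_smul, map_mul, map_mul,
      mul_comm (g (GaddisHeisenberg.y 1 1))]
    simp
  classical
  let s : Finset (Fin 3 → K) :=
    {(g (GaddisHeisenberg.x 1 1)).snd, (g (GaddisHeisenberg.y 1 1)).snd}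
  obtain ⟨i, hi⟩ := exists_single_notMem_span (s := s) (Finset.card_le_two.trans_lt (by simp))
  have hmem (w) := GaddisHeisenberg.map_mem g (subalgebraOfSubmodule
    (Submodule.span K (s : Set (Fin 3 → K))))
    (Submodule.subset_span (by simp [s])) (Submodule.subset_span (by simp [s]))
    (by rw [hc0]; exact zero_mem _) w
  apply hi
  fin_cases i
  · simpa [g, ψ, mem_subalgebraOfSubmodule] using hmem (e.symm (GenHeisenberg.x f))
  · simpa [g, ψ, mem_subalgebraOfSubmodule] using hmem (e.symm (GenHeisenberg.y f))
  · simpa [g, ψ, T, mem_subalgebraOfSubmodule, TrivSqZeroExt.algebraMap_eq_inl] using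
      hmem (e.symm (GenHeisenberg.t f))

/-- The algebra of upper triangular `2 × 2` matrices. -/
def upperTriangularSubalgebra (K : Type*) [Field K] :
    Subalgebra K (Matrix (Fin 2) (Fin 2) K) where
  carrier := {M | M 1 0 = 0}
  mul_mem' {a b} ha hb := by
    simp only [Set.mem_ofPred_eq] at ha hb
    simp [Matrix.mul_apply, ha, hb]
  add_mem' {a b} ha hb := by
    simp only [Set.mem_ofPred_eq] at ha hb
    simp [ha, hb]
  algebraMap_mem' r := by simp [Matrix.algebraMap_matrix_apply]

/-- If a homomorphism out of `GH_{1,1}` takes upper triangular values, one of which has distinct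
diagonal entries, then it kills the central commutator `t`. -/
theorem GaddisHeisenberg.map_t_eq_zero
    (g : GaddisHeisenberg (1 : Kˣ) 1 →ₐ[K] Matrix (Fin 2) (Fin 2) K)
    (hg : ∀ w, g w ∈ upperTriangularSubalgebra K) (w : GaddisHeisenberg (1 : Kˣ) 1)
    (hw : g w 0 0 ≠ g w 1 1) : g (t 1 1) = 0 := by
  have hxt := congrArg g (x_mul_t (p := (1 : Kˣ)) (q := 1))
  have hyt := congrArg g (y_mul_t (p := (1 : Kˣ)) (q := 1))
  have hyx := congrArg g (y_mul_x (p := (1 : Kˣ)) (q := 1))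
  simp only [inv_one, Units.val_one, one_smul, map_mul, map_sub] at hxt hyt hyx
  have ha : g (x 1 1) 1 0 = 0 := hg _
  have hb : g (y 1 1) 1 0 = 0 := hg _
  -- A strictly upper triangular matrix commuting with one of distinct diagonal entries is zero.
  have hc : g (t 1 1) * g w = g w * g (t 1 1) := by
    have h : g w ∈ Subalgebra.centralizer K {g (t 1 1)} := by
      apply map_mem <;>
        simp only [Subalgebra.mem_centralizer_iff, Set.mem_singleton_iff, forall_eq]
      · exact hxt.symm
      · exact hyt.symm
    exact h _ rfl
  generalize g (x 1 1) = a at *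
  generalize g (y 1 1) = b at *
  generalize g (t 1 1) = c at *
  have hw10 : g w 1 0 = 0 := hg w
  have hc00 : c 0 0 = 0 := by
    rw [← hyx]; simp [Matrix.mul_apply, ha, hb, mul_comm]
  have hc10 : c 1 0 = 0 := by
    rw [← hyx]; simp [Matrix.mul_apply, ha, hb]
  have hc11 : c 1 1 = 0 := by
    rw [← hyx]; simp [Matrix.mul_apply, ha, hb, mul_comm]
  have h01 := congrFun (congrFun hc 0) 1
  simp only [Matrix.mul_apply, Fin.sum_univ_two, hc00, hc11, zero_mul, mul_zero, zero_add,
    add_zero] at h01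
  have hc01 : c 0 1 = 0 := by
    have h : (g w 0 0 - g w 1 1) * c 0 1 = 0 := by linear_combination -h01
    exact (mul_eq_zero.mp h).resolve_left (sub_ne_zero.mpr hw)
  ext i j
  fin_cases i <;> fin_cases j <;> assumption

/-- A homomorphism out of `GH_{1,1}` that kills `t` has commutative image. -/
theorem GaddisHeisenberg.map_commute {A : Type*} [Ring A] [Algebra K A]
    (g : GaddisHeisenberg (1 : Kˣ) 1 →ₐ[K] A) (ht : g (t 1 1) = 0)
    (v w : GaddisHeisenberg (1 : Kˣ) 1) : Commute (g v) (g w) := by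
  have hyx := congrArg g (y_mul_x (p := (1 : Kˣ)) (q := 1))
  rw [ht, Units.val_one, one_smul, map_sub, map_mul, map_mul, sub_eq_zero] at hyx
  -- Two passes: every value commutes with the images of `x` and `y`, hence with every other value.
  have hxy (w) : g w ∈ Subalgebra.centralizer K {g (x 1 1), g (y 1 1)} := by
    apply map_mem
    · simp [Subalgebra.mem_centralizer_iff, hyx]
    · simp [Subalgebra.mem_centralizer_iff, hyx]
    · rw [ht]; exact zero_mem _
  have h : g w ∈ Subalgebra.centralizer K {g v} := by
    apply map_mem <;>
      simp only [Subalgebra.mem_centralizer_iff, Set.mem_singleton_iff, forall_eq]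
    · exact (hxy v _ (by simp)).symm
    · exact (hxy v _ (by simp)).symm
    · simp [ht]
  exact h _ rfl

theorem GaddisHeisenberg.isEmpty_equiv_of_derivative_ne_one {t₀ : K} (hfix : f.eval t₀ = t₀)
    (hder : f.derivative.eval t₀ ≠ 1) :
    IsEmpty (GaddisHeisenberg (1 : Kˣ) 1 ≃ₐ[K] GenHeisenberg f) := by
  refine ⟨fun e => ?_⟩
  set l := f.derivative.eval t₀
  let N : Matrix (Fin 2) (Fin 2) K := !![0, 1; 0, 0]
  have hN : N * N = 0 := by ext i j; fin_cases i <;> fin_cases j <;> simp [N]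
  have hT : algebraMap K (Matrix (Fin 2) (Fin 2) K) t₀ + N = !![t₀, 1; 0, t₀] := by
    ext i j; fin_cases i <;> fin_cases j <;> simp [N, Matrix.algebraMap_matrix_apply]
  have hev : aeval (!![t₀, 1; 0, t₀] : Matrix (Fin 2) (Fin 2) K) f = !![t₀, l; 0, t₀] := by
    rw [← hT, aeval_algebraMap_add_of_sq_eq_zero _ _ hN, hfix]
    ext i j; fin_cases i <;> fin_cases j <;> simp [N, l, Matrix.algebraMap_matrix_apply]
  let ψ : GenHeisenberg f →ₐ[K] Matrix (Fin 2) (Fin 2) K :=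
    -- Corner entries dictate the matrices: `tx = xf` forces diagonal `(d, ld)` on `x`, `yt = fy`
    -- forces `(le, e)` on `y`, and the corner 1 of `x` makes `yx - xy` have corner `l - 1`.
    GenHeisenberg.lift !![1, 1; 0, l] !![l, 0; 0, 1] !![t₀, 1; 0, t₀]
      (by rw [hev]; ext i j; fin_cases i <;> fin_cases j <;> simp <;> ring)
      (by rw [hev]; ext i j; fin_cases i <;> fin_cases j <;> simp <;> ring)
      (by rw [hev]; ext i j; fin_cases i <;> fin_cases j <;> simp)
  let g : GaddisHeisenberg (1 : Kˣ) 1 →ₐ[K] Matrix (Fin 2) (Fin 2) K := ψ.comp e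
  have hψx : ψ (GenHeisenberg.x f) = !![1, 1; 0, l] := GenHeisenberg.lift_x _ _ _
  have hψt : ψ (GenHeisenberg.t f) = !![t₀, 1; 0, t₀] := GenHeisenberg.lift_t _ _ _
  have hψ (w) : ψ w ∈ upperTriangularSubalgebra K :=
    GenHeisenberg.map_mem ψ _ (by rw [hψx]; exact rfl)
      (by rw [GenHeisenberg.lift_y]; exact rfl) (by rw [hψt]; exact rfl) w
  have hsurj (w) : ψ w = g (e.symm w) := by simp [g]
  have ht := GaddisHeisenberg.map_t_eq_zero g (fun w => hψ _) (e.symm (GenHeisenberg.x f))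
    (by rw [← hsurj, hψx]; simpa [eq_comm] using hder)
  have h := GaddisHeisenberg.map_commute g ht (e.symm (GenHeisenberg.x f))
    (e.symm (GenHeisenberg.t f))
  rw [← hsurj, ← hsurj, hψx, hψt] at h
  have h01 : 1 + t₀ = t₀ + l := by simpa using congrFun (congrFun h.eq 0) 1
  exact hder (by linear_combination -h01)

theorem GaddisHeisenberg.isEmpty_equiv_of_eq_one :
    IsEmpty (GaddisHeisenberg (1 : Kˣ) 1 ≃ₐ[K] GenHeisenberg f) := by
  refine ⟨fun e => ?_⟩
  -- Here the character only serves to produce a fixed point of `f`; any other would do.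
  have hfix := GenHeisenberg.eval_char ((GaddisHeisenberg.char (1 : Kˣ) 1).comp e.symm.toAlgHom)
  by_cases hder : f.derivative.eval
      (((GaddisHeisenberg.char (1 : Kˣ) 1).comp e.symm.toAlgHom) (GenHeisenberg.t f)) = 1
  · exact (GaddisHeisenberg.isEmpty_equiv_of_derivative_eq_one hfix hder).false e
  · exact (GaddisHeisenberg.isEmpty_equiv_of_derivative_ne_one hfix hder).false e

end Nonexistence

theorem mainTheorem4 {K : Type*} [Field K] :
    (∀ p q : Kˣ,
      ((∃ f : Polynomial K, Nonempty (GaddisHeisenberg p q ≃ₐ[K] GenHeisenberg f)) ↔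
        ((p = 1 ∧ q ≠ 1) ∨ (p ≠ 1 ∧ q = 1))) ∧
      (p = 1 ∧ q ≠ 1 → Nonempty (GaddisHeisenberg p q ≃ₐ[K]
        GenHeisenberg (Polynomial.C (q : K) * Polynomial.X))) ∧
      (p ≠ 1 ∧ q = 1 → Nonempty (GaddisHeisenberg p q ≃ₐ[K]
        GenHeisenberg (Polynomial.C (p : K) * Polynomial.X)))) ∧
    Nonempty (UniversalEnvelopingAlgebra K (HeisenbergLieAlgebra K) ≃ₐ[K]
      GaddisHeisenberg (1 : Kˣ) (1 : Kˣ)) ∧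
    (¬ ∃ f : Polynomial K, Nonempty (GaddisHeisenberg (1 : Kˣ) (1 : Kˣ) ≃ₐ[K]
      GenHeisenberg f)) ∧
    (¬ ∃ f : Polynomial K, Nonempty
      (UniversalEnvelopingAlgebra K (HeisenbergLieAlgebra K) ≃ₐ[K] GenHeisenberg f)) := by
  have key (p q : Kˣ) (h : ∃ f : Polynomial K,
      Nonempty (GaddisHeisenberg p q ≃ₐ[K] GenHeisenberg f)) :
      (p = 1 ∧ q ≠ 1) ∨ (p ≠ 1 ∧ q = 1) := by
    obtain ⟨f, ⟨e⟩⟩ := h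
    by_cases hp : p = 1 <;> by_cases hq : q = 1
    · subst hp hq
      exact (GaddisHeisenberg.isEmpty_equiv_of_eq_one.false e).elim
    · exact Or.inl ⟨hp, hq⟩
    · exact Or.inr ⟨hp, hq⟩
    · exact ((GaddisHeisenberg.isEmpty_equiv_of_ne_one hp hq).false e).elim
  have iso_left (p q : Kˣ) : p = 1 ∧ q ≠ 1 → Nonempty (GaddisHeisenberg p q ≃ₐ[K]
      GenHeisenberg (Polynomial.C (q : K) * Polynomial.X)) := by
    rintro ⟨rfl, hq⟩
    exact GaddisHeisenberg.nonempty_equiv_of_ne_one hq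
  have iso_right (p q : Kˣ) : p ≠ 1 ∧ q = 1 → Nonempty (GaddisHeisenberg p q ≃ₐ[K]
      GenHeisenberg (Polynomial.C (p : K) * Polynomial.X)) := by
    rintro ⟨hp, rfl⟩
    exact GaddisHeisenberg.nonempty_equiv_of_one_right hp
  obtain ⟨u⟩ := HeisenbergLieAlgebra.nonempty_universalEnvelopingAlgebra_equiv K
  refine ⟨fun p q => ⟨⟨key p q, ?_⟩, iso_left p q, iso_right p q⟩, ⟨u⟩, ?_, ?_⟩
  · rintro (h | h)
    · exact ⟨_, iso_left p q h⟩
    · exact ⟨_, iso_right p q h⟩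
  · rintro ⟨f, ⟨e⟩⟩
    exact GaddisHeisenberg.isEmpty_equiv_of_eq_one.false e
  · rintro ⟨f, ⟨e⟩⟩
    exact GaddisHeisenberg.isEmpty_equiv_of_eq_one.false (u.symm.trans e)
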